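/- **Setting.** Fix $R\ge 1$, $p_0,p_1,\dots,p_R>0$ and $\sigma_{f_r},\sigma_{g_r}>0$ ($1\le r\le R$). Let $\mathbf h=(f_1,g_1,\dots,f_R,g_R)$ have independent entries $f_r\sim\mathcal{CN}(0,\sigma_{f_r}^2)$, $g_r\sim\mathcal{CN}(0,\sigma_{g_r}^2)$. For $P>0$ put $P_i=p_iP$, $\rho_r=P_r/(1+|f_r|^2P_0)$ and, for $\mathbf x\in\mathbb C^R$, $$\mathrm{SNR}_P(\mathbf x,\mathbf h)=\frac{P_0\left|\sum_{r=1}^R x_rf_rg_r\sqrt{\rho_r}\right|^2}{1+\sum_{r=1}^R|x_r|^2|g_r|^2\rho_r}.$$ A *codebook* is a nonempty compact subset of $\mathcal X=\{\mathbf x\in\mathbb C^R:\max_r|x_r|=1\}$. The symbol error rate of a codebook $\mathcal C$ is $\mathrm{SER}_P(\mathcal C)=\mathrm E_{\mathbf h}\big[\mathrm Q\big(\sqrt{2\,\mathrm{SNR}_P(\mathcal Q(\mathbf h),\mathbf h)}\big)\big]$, where $\mathcal Q(\mathbf h)\in\arg\max_{\mathbf x\in\mathcal C}\mathrm{SNR}_P(\mathbf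 x,\mathbf h)$ and $\mathrm Q$ is the Gaussian tail function. A *d-codebook* $\mathcal D$ assigns to each $P>0$ a codebook $\mathcal D_P$, all of the same (possibly infinite) cardinality $|\mathcal D|$. It has *diversity* $R$ if $\lim_{P\to\infty}-\log\mathrm{SER}_P(\mathcal D_P)/\log P=R$. It is *SER-optimal* if for every $P>0$ no codebook of cardinality $|\mathcal D|$ has a smaller $\mathrm{SER}_P$ than $\mathcal D_P$. An *SRS codebook* is a set $\{e^{i\theta_1}\mathbf e_1,\dots,e^{i\theta_R}\mathbf e_R\}$ with $\theta_r\in\mathbb R$, where $\mathbf e_1,\dots,\mathbf e_R$ are the standard unit vectors. With $d_P(\mathbf x)=\min_{\mathbf y\in\mathcal D_P}\|\mathbf x-\mathbf y\|$, the upper limit is $\limsup\mathcal D=\{\mathbf x\in\mathbb C^R:\liminf_{P\to\infty}d_P(\mathbf x)=0\}$ and the lower limit is $\liminf\mathcal D=\{\mathbf x\in\mathbb C^R:\lim_{P\to\infty}d_P(\mathbf x)=0\}$; if the two agree, $\lim\mathcal D$ exists and is their common value. **Theorem.** There are constants $0<C,P^\star<\infty$, depending only on $R$, the $p_i$, the $\sigma_{f_r}$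 and the $\sigma_{g_r}$, such that the following hold for every d-codebook $\mathcal D$ with diversity $R$. 1. There is $P_{\mathcal D}>0$ such that for all $P>P_{\mathcal D}$ there are $R$ distinct vectors $\tilde{\mathbf e}_{1,P},\dots,\tilde{\mathbf e}_{R,P}$ in $\mathcal D_P$ with $$|\tilde e_{r,P,q}|^2\le\frac{C}{\log P}\qquad\text{for all } r,q\in\{1,\dots,R\},\ q\ne r,$$ where $\tilde e_{r,P,q}$ is the $q$th component of $\tilde{\mathbf e}_{r,P}$. If $\mathcal D$ is moreover SER-optimal, this holds for all $P>P^\star$. 2. Suppose that $\lim\mathcal D$ exists. (a) If $|\mathcal D|=R$, then $\lim\mathcal D$ is an SRS codebook. (b) If $|\mathcal D|>R$, then $\lim\mathcal D$ contains an SRS codebook. 3. If $\lim\mathcal D$ does not exist, then $\limsup\mathcal D$ contains an SRS codebook. -/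

import Mathlib

open MeasureTheory ProbabilityTheory Filter Topology
open scoped NNReal

noncomputable section

/-- Beamforming vectors: `ℂ^R` with the Euclidean norm. -/
abbrev BeamVec (R : ℕ) : Type := EuclideanSpace ℂ (Fin R)

/-- Channel states `h = (f₁, g₁, …, f_R, g_R)`: `(h r).1 = f_r`, `(h r).2 = g_r`. -/
abbrev ChannelState (R : ℕ) : Type := Fin R → ℂ × ℂ

/-- The law `CN(0, σ²)`: independent real and imaginary parts, each `N(0, σ²/2)`. -/
def complexNormal (σ : ℝ≥0) : Measure ℂ :=
  ((gaussianReal 0 (σ ^ 2 / 2)).prod (gaussianReal 0 (σ ^ 2 / 2))).map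
    (fun z : ℝ × ℝ => (⟨z.1, z.2⟩ : ℂ))

/-- The Gaussian tail function. -/
def gaussianQ (x : ℝ) : ℝ :=
  (Real.sqrt (2 * Real.pi))⁻¹ * ∫ t in Set.Ioi x, Real.exp (-t ^ 2 / 2)

/-- The fixed parameters of the network with `R` relays: power scalers `p₀, p₁, …, p_R` and
channel standard deviations, all positive. -/
structure RelayNetwork (R : ℕ) where
  p₀ : ℝ
  p : Fin R → ℝ
  σf : Fin R → ℝ≥0
  σg : Fin R → ℝ≥0
  p₀_pos : 0 < p₀
  p_pos : ∀ r, 0 < p r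
  σf_pos : ∀ r, 0 < σf r
  σg_pos : ∀ r, 0 < σg r

namespace RelayNetwork

variable {R : ℕ} (N : RelayNetwork R)

/-- The law of the channel state: all entries independent, `f_r ∼ CN(0, σf_r²)` and
`g_r ∼ CN(0, σg_r²)`. -/
def channelLaw : Measure (ChannelState R) :=
  Measure.pi fun r => (complexNormal (N.σf r)).prod (complexNormal (N.σg r))

/-- The relay normalization factor `ρ_r = P_r / (1 + |f_r|² P₀)`, with `P_i = p_i P`. -/
def rho (P : ℝ) (h : ChannelState R) (r : Fin R) : ℝ :=
  N.p r * P / (1 + ‖(h r).1‖ ^ 2 * (N.p₀ * P))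

/-- The received signal-to-noise ratio. -/
def snr (P : ℝ) (x : BeamVec R) (h : ChannelState R) : ℝ :=
  (N.p₀ * P * ‖∑ r, x r * (h r).1 * (h r).2 * (Real.sqrt (N.rho P h r) : ℂ)‖ ^ 2) /
    (1 + ∑ r, ‖x r‖ ^ 2 * ‖(h r).2‖ ^ 2 * N.rho P h r)

/-- The symbol error rate of a quantizer `q` at power level `P` (binary constellation). -/
def quantizerSER (P : ℝ) (q : ChannelState R → BeamVec R) : ℝ :=
  ∫ h, gaussianQ (Real.sqrt (2 * N.snr P (q h) h)) ∂N.channelLaw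

/-- `x` is a maximizer of the received SNR over the codebook `C` for the channel state `h`. -/
def IsBest (P : ℝ) (C : Set (BeamVec R)) (h : ChannelState R) (x : BeamVec R) : Prop :=
  x ∈ C ∧ ∀ y ∈ C, N.snr P y h ≤ N.snr P x h

open Classical in
/-- The optimal quantizer `h ↦ argmax_{x ∈ C} SNR_P(x, h)` for the codebook `C`. Ties are broken
arbitrarily, which does not affect the attained SNR. The default value is not used when
`C` is compact and nonempty (`isBest_bestQuantizer`). -/
def bestQuantizer (P : ℝ) (C : Set (BeamVec R)) (h : ChannelState R) : BeamVec R :=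
  if hx : ∃ x, N.IsBest P C h x then hx.choose else 0

/-- The symbol error rate of the codebook `C` at power level `P`, used with its optimal
quantizer. -/
def SER (P : ℝ) (C : Set (BeamVec R)) : ℝ :=
  N.quantizerSER P (N.bestQuantizer P C)

theorem rho_nonneg {P : ℝ} (hP : 0 < P) (h : ChannelState R) (r : Fin R) :
    0 ≤ N.rho P h r := by
  have h1 := N.p_pos r
  have h2 := N.p₀_pos
  unfold rho
  positivity

theorem continuous_snr {P : ℝ} (hP : 0 < P) (h : ChannelState R) :
    Continuous fun x : BeamVec R => N.snr P x h := by
  unfold snr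
  refine Continuous.div (by fun_prop) (by fun_prop) fun x => ?_
  have : 0 ≤ ∑ r, ‖x r‖ ^ 2 * ‖(h r).2‖ ^ 2 * N.rho P h r :=
    Finset.sum_nonneg fun r _ => mul_nonneg (by positivity) (N.rho_nonneg hP h r)
  linarith

theorem isBest_bestQuantizer {P : ℝ} (hP : 0 < P) {C : Set (BeamVec R)} (hC : IsCompact C)
    (hne : C.Nonempty) (h : ChannelState R) : N.IsBest P C h (N.bestQuantizer P C h) := by
  have hx : ∃ x, N.IsBest P C h x := by
    obtain ⟨x, hxC, hx⟩ := hC.exists_isMaxOn hne (N.continuous_snr hP h).continuousOn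
    exact ⟨x, hxC, fun y hy => hx hy⟩
  unfold bestQuantizer
  rw [dif_pos hx]
  exact hx.choose_spec

end RelayNetwork

/-- Admissible codebooks: nonempty compact sets of vectors of infinity-norm one. (The norm of
`x.ofLp : Fin R → ℂ` is the maximum of the `|x_r|`.) -/
structure IsCodebook {R : ℕ} (C : Set (BeamVec R)) : Prop where
  nonempty : C.Nonempty
  isCompact : IsCompact C
  norm_eq_one : ∀ x ∈ C, ‖x.ofLp‖ = 1

/-- A power-dependent codebook `P ↦ D_P`, `P > 0`, all `D_P` having the same cardinality `card`
(possibly infinite). Values at `P ≤ 0` are irrelevant. -/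
structure DCodebook (R : ℕ) where
  book : ℝ → Set (BeamVec R)
  card : ℕ∞
  isCodebook : ∀ P, 0 < P → IsCodebook (book P)
  encard_eq : ∀ P, 0 < P → (book P).encard = card

/-- The d-codebook `D` has diversity `d`: `-log SER_P(D_P) / log P → d` as `P → ∞`. -/
def RelayNetwork.HasDiversity {R : ℕ} (N : RelayNetwork R) (D : DCodebook R) (d : ℝ) : Prop :=
  Tendsto (fun P : ℝ => -Real.log (N.SER P (D.book P)) / Real.log P) atTop (𝓝 d)

/-- The d-codebook `D` is SER-optimal: at every power level, no codebook of the same cardinality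
has a smaller symbol error rate. -/
def RelayNetwork.IsSEROptimal {R : ℕ} (N : RelayNetwork R) (D : DCodebook R) : Prop :=
  ∀ P, 0 < P → ∀ C : Set (BeamVec R), IsCodebook C → C.encard = D.card →
    N.SER P (D.book P) ≤ N.SER P C

/-- The single-relay selection codebook with phases `θ`: its `r`th vector has `r`th entry
`exp(i θ_r)` and all other entries `0`. -/
def srsCodebook {R : ℕ} (θ : Fin R → ℝ) : Set (BeamVec R) :=
  Set.range fun r => EuclideanSpace.single r (Complex.exp (θ r * Complex.I))

namespace DCodebook

variable {R : ℕ} (D : DCodebook R)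

/-- The upper limit of `D_P` as `P → ∞`. -/
def upperLimit : Set (BeamVec R) :=
  {x | liminf (fun P : ℝ => Metric.infDist x (D.book P)) atTop = 0}

/-- The lower limit of `D_P` as `P → ∞`. -/
def lowerLimit : Set (BeamVec R) :=
  {x | Tendsto (fun P : ℝ => Metric.infDist x (D.book P)) atTop (𝓝 0)}

/-- `lim D` exists and equals `L`: the lower and the upper limit both equal `L`. -/
def HasLimit (L : Set (BeamVec R)) : Prop :=
  D.lowerLimit = L ∧ D.upperLimit = L

/-- There are `R` distinct vectors in `D_P` such that every component of the `r`th one, other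
than the `r`th component, has squared modulus at most `c`. -/
def HasNearSRS (P c : ℝ) : Prop :=
  ∃ e : Fin R → BeamVec R, Function.Injective e ∧ (∀ r, e r ∈ D.book P) ∧
    ∀ r q, q ≠ r → ‖e r q‖ ^ 2 ≤ c

end DCodebook

end

/-!
The theorem rests on two bounds for the symbol error rate at high power.

*Lower bound* (`RelayNetwork.le_SER_of_forall_exists`). Suppose that for some relay `r` every
codeword `x` has a component `x_q`, `q ≠ r`, with `|x_q|² > C / log P`. Consider the event that
`|f_q|² ≤ 1 / P` and `|g_q| ≥ 1` for all `q ≠ r`, while `|g_r| ≤ 1`; its probability is of order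
`P ^ (-(R - 1))`. There the relays `q ≠ r` contribute a bounded SNR, and relay `r` a signal of power
`O(P)`, but some relay `q ≠ r` forwards noise of power at least of order `C P / log P`. So the SNR
is `O(1) + O((log P) / C)`. If `C` is large, the error rate given the event is at least of order
`P ^ (-1/2)`, and that of the codebook at least of order `P ^ (-R + 1/2)`. This is incompatible with
diversity `R`, so for large `P` each relay `r` has a codeword whose other components are small.
These codewords are distinct because codewords have sup norm one.

*Upper bound* (`RelayNetwork.SER_le_of_single_mem`). A codebook containing the standard unit vectors
has error rate at most of order `(log P / P) ^ R`, with constants depending only on the network. A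
codebook of the same cardinality as `D` with this property exists, since `|D| ≥ R`
(`exists_isCodebook_single_mem`), so the error rate of an SER-optimal `D` is below the lower bound
from a power level on that does not depend on `D`.

For the limits, take an ultrafilter finer than `atTop`. Along it the codeword near the `r`th axis
converges to some `exp (i θ_r) e_r`, a point of the upper limit. If `|D| = R`, these codewords are
all of `D_P`, so every point of the lower limit is one of the `exp (i θ_r) e_r`
(`DCodebook.exists_srsCodebook_subset`).
-/

/-! ### The Gaussian tail function -/

theorem integrable_exp_neg_sq_half : Integrable fun t : ℝ => Real.exp (-t ^ 2 / 2) := by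
  refine (integrable_exp_neg_mul_sq (b := 1 / 2) (by norm_num)).congr (ae_of_all _ fun t => ?_)
  simp only
  congr 1
  ring

theorem gaussianQ_nonneg (x : ℝ) : 0 ≤ gaussianQ x :=
  mul_nonneg (by positivity) (integral_nonneg fun t => (Real.exp_pos _).le)

theorem gaussianQ_antitone : Antitone gaussianQ := fun x y hxy =>
  mul_le_mul_of_nonneg_left
    (setIntegral_mono_set integrable_exp_neg_sq_half.integrableOn
      (ae_of_all _ fun t => (Real.exp_pos _).le) (Set.Ioi_subset_Ioi hxy).eventuallyLE)
    (by positivity)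

theorem gaussianQ_le {x : ℝ} (hx : 0 ≤ x) : gaussianQ x ≤ 2 * Real.exp (-x ^ 2 / 4) := by
  have hint : Integrable fun t : ℝ => Real.exp (-(1 / 4) * t ^ 2) :=
    integrable_exp_neg_mul_sq (by norm_num)
  -- For `t > x ≥ 0` the exponent satisfies `t² / 2 ≥ x² / 4 + t² / 4`.
  have h1 : ∫ t in Set.Ioi x, Real.exp (-t ^ 2 / 2) ≤
      ∫ t in Set.Ioi x, Real.exp (-x ^ 2 / 4) * Real.exp (-(1 / 4) * t ^ 2) := by
    refine setIntegral_mono_on integrable_exp_neg_sq_half.integrableOn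
      (hint.const_mul _).integrableOn measurableSet_Ioi fun t ht => ?_
    rw [← Real.exp_add]
    refine Real.exp_le_exp.2 ?_
    have : x ^ 2 ≤ t ^ 2 := pow_le_pow_left₀ hx (le_of_lt ht) 2
    linarith
  have h2 : ∫ t in Set.Ioi x, Real.exp (-(1 / 4) * t ^ 2) ≤ Real.sqrt (4 * Real.pi) := by
    refine (setIntegral_le_integral hint (ae_of_all _ fun t => (Real.exp_pos _).le)).trans ?_
    rw [integral_gaussian]
    apply Real.sqrt_le_sqrt
    linarith
  rw [integral_const_mul] at h1
  have h3 : Real.sqrt (4 * Real.pi) ≤ 2 * Real.sqrt (2 * Real.pi) := by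
    refine Real.sqrt_le_iff.2 ⟨by positivity, ?_⟩
    rw [mul_pow, Real.sq_sqrt (by positivity)]
    linarith [Real.pi_pos]
  have h5 : 0 < Real.sqrt (2 * Real.pi) := Real.sqrt_pos.2 (by positivity)
  unfold gaussianQ
  rw [inv_mul_le_iff₀ h5]
  have h6 := Real.exp_pos (-x ^ 2 / 4)
  nlinarith [mul_le_mul_of_nonneg_left (h2.trans h3) h6.le]

theorem gaussianQ_le_two {x : ℝ} (hx : 0 ≤ x) : gaussianQ x ≤ 2 := by
  have h1 : Real.exp (-x ^ 2 / 4) ≤ 1 := Real.exp_le_one_iff.2 (by nlinarith [sq_nonneg x])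
  linarith [gaussianQ_le hx]

theorem le_gaussianQ {x : ℝ} (hx : 0 ≤ x) :
    (Real.sqrt (2 * Real.pi))⁻¹ * Real.exp (-1 - x ^ 2) ≤ gaussianQ x := by
  refine mul_le_mul_of_nonneg_left ?_ (by positivity)
  calc Real.exp (-1 - x ^ 2) = ∫ _ in Set.Ioc x (x + 1), Real.exp (-1 - x ^ 2) := by simp
    _ ≤ ∫ t in Set.Ioc x (x + 1), Real.exp (-t ^ 2 / 2) := by
        refine setIntegral_mono_on (by simp) integrable_exp_neg_sq_half.integrableOn
          measurableSet_Ioc fun t ht => Real.exp_le_exp.2 ?_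
        nlinarith [ht.1, ht.2, sq_nonneg (x - 1)]
    _ ≤ ∫ t in Set.Ioi x, Real.exp (-t ^ 2 / 2) :=
        setIntegral_mono_set integrable_exp_neg_sq_half.integrableOn
          (ae_of_all _ fun t => (Real.exp_pos _).le) Set.Ioc_subset_Ioi_self.eventuallyLE

/-! ### Disk probabilities of the complex normal law -/

theorem gaussianReal_Icc_le {v : ℝ≥0} (hv : v ≠ 0) {a b : ℝ} (hab : a ≤ b) :
    (gaussianReal 0 v).real (Set.Icc a b) ≤ (Real.sqrt (2 * Real.pi * v))⁻¹ * (b - a) := by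
  have h0 : ∀ x, gaussianPDFReal 0 v x ≤ (Real.sqrt (2 * Real.pi * v))⁻¹ := fun x => by
    rw [gaussianPDFReal_def]
    refine mul_le_of_le_one_right (by positivity) (Real.exp_le_one_iff.2 ?_)
    rw [neg_div]
    exact neg_nonpos.2 (by positivity)
  have h1 : ∫ x in Set.Icc a b, gaussianPDFReal 0 v x ≤
      ∫ _ in Set.Icc a b, (Real.sqrt (2 * Real.pi * v))⁻¹ :=
    setIntegral_mono_on (integrable_gaussianPDFReal 0 v).integrableOn
      (integrableOn_const measure_Icc_lt_top.ne) measurableSet_Icc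
      fun x _ => h0 x
  rw [measureReal_def, gaussianReal_apply_eq_integral 0 hv, ENNReal.toReal_ofReal
    (integral_nonneg fun x => gaussianPDFReal_nonneg 0 v x)]
  refine h1.trans_eq ?_
  simp [hab, mul_comm]

theorem le_gaussianReal_Icc {v : ℝ≥0} (hv : v ≠ 0) {M a b : ℝ} (hab : a ≤ b) (ha : -M ≤ a)
    (hb : b ≤ M) :
    (Real.sqrt (2 * Real.pi * v))⁻¹ * Real.exp (-M ^ 2 / (2 * v)) * (b - a) ≤
      (gaussianReal 0 v).real (Set.Icc a b) := by
  have h1 : ∫ _ in Set.Icc a b, (Real.sqrt (2 * Real.pi * v))⁻¹ * Real.exp (-M ^ 2 / (2 * v)) ≤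
      ∫ x in Set.Icc a b, gaussianPDFReal 0 v x := by
    refine setIntegral_mono_on (integrableOn_const measure_Icc_lt_top.ne)
      (integrable_gaussianPDFReal 0 v).integrableOn
      measurableSet_Icc fun x hx => ?_
    rw [gaussianPDFReal_def]
    refine mul_le_mul_of_nonneg_left (Real.exp_le_exp.2 ?_) (by positivity)
    have h2 : (x - 0) ^ 2 ≤ M ^ 2 := sq_le_sq' (by linarith [hx.1]) (by linarith [hx.2])
    gcongr
  rw [measureReal_def, gaussianReal_apply_eq_integral 0 hv, ENNReal.toReal_ofReal
    (integral_nonneg fun x => gaussianPDFReal_nonneg 0 v x)]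
  refine le_of_eq_of_le ?_ h1
  simp [hab, mul_comm]

theorem measurable_complex_mk : Measurable fun z : ℝ × ℝ => (⟨z.1, z.2⟩ : ℂ) :=
  Complex.measurableEquivRealProd.symm.measurable

instance (σ : ℝ≥0) : IsProbabilityMeasure (complexNormal σ) :=
  Measure.isProbabilityMeasure_map measurable_complex_mk.aemeasurable

theorem complexNormal_real_reProdIm (σ : ℝ≥0) {s t : Set ℝ} (hs : MeasurableSet s)
    (ht : MeasurableSet t) :
    (complexNormal σ).real (s ×ℂ t) =
      (gaussianReal 0 (σ ^ 2 / 2)).real s * (gaussianReal 0 (σ ^ 2 / 2)).real t := by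
  have h : MeasurableSet (s ×ℂ t) :=
    (Complex.measurable_re hs).inter (Complex.measurable_im ht)
  rw [measureReal_def, complexNormal, Measure.map_apply measurable_complex_mk h]
  have h2 : (fun z : ℝ × ℝ => (⟨z.1, z.2⟩ : ℂ)) ⁻¹' (s ×ℂ t) = s ×ˢ t := by
    ext z
    simp [Complex.mem_reProdIm]
  rw [h2, Measure.prod_prod, ENNReal.toReal_mul]
  rfl

theorem complexNormal_disk_le {σ : ℝ≥0} (hσ : 0 < σ) :
    ∃ K : ℝ, 0 < K ∧ ∀ t : ℝ, 0 ≤ t → (complexNormal σ).real {z | ‖z‖ ^ 2 ≤ t} ≤ K * t := by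
  have hv : σ ^ 2 / 2 ≠ 0 := (by positivity : 0 < σ ^ 2 / 2).ne'
  have hv' : (0 : ℝ) < (σ ^ 2 / 2 : ℝ≥0) := NNReal.coe_pos.2 (by positivity)
  set d : ℝ := (Real.sqrt (2 * Real.pi * (σ ^ 2 / 2 : ℝ≥0)))⁻¹ with hd
  have hdpos : 0 < d := inv_pos.2 (Real.sqrt_pos.2 (by positivity))
  refine ⟨4 * d ^ 2, by positivity, fun t ht => ?_⟩
  have hsub : {z : ℂ | ‖z‖ ^ 2 ≤ t} ⊆
      Set.Icc (-Real.sqrt t) (Real.sqrt t) ×ℂ Set.Icc (-Real.sqrt t) (Real.sqrt t) := by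
    intro z hz
    have hz' : ‖z‖ ≤ Real.sqrt t := Real.le_sqrt_of_sq_le hz
    exact ⟨abs_le.1 ((Complex.abs_re_le_norm z).trans hz'),
      abs_le.1 ((Complex.abs_im_le_norm z).trans hz')⟩
  refine (measureReal_mono hsub).trans ?_
  rw [complexNormal_real_reProdIm σ measurableSet_Icc measurableSet_Icc]
  have h1 := gaussianReal_Icc_le hv (a := -Real.sqrt t) (b := Real.sqrt t)
    (by linarith [Real.sqrt_nonneg t])
  refine (mul_le_mul h1 h1 measureReal_nonneg ?_).trans_eq ?_
  · exact measureReal_nonneg.trans h1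
  · rw [← hd]
    linear_combination 4 * d ^ 2 * Real.sq_sqrt ht

theorem le_complexNormal_disk {σ : ℝ≥0} (hσ : 0 < σ) :
    ∃ k : ℝ, 0 < k ∧ ∀ t : ℝ, 0 ≤ t → t ≤ 1 → k * t ≤ (complexNormal σ).real {z | ‖z‖ ^ 2 ≤ t} := by
  have hv : σ ^ 2 / 2 ≠ 0 := (by positivity : 0 < σ ^ 2 / 2).ne'
  have hv' : (0 : ℝ) < (σ ^ 2 / 2 : ℝ≥0) := NNReal.coe_pos.2 (by positivity)
  set d : ℝ := (Real.sqrt (2 * Real.pi * (σ ^ 2 / 2 : ℝ≥0)))⁻¹ *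
    Real.exp (-1 ^ 2 / (2 * (σ ^ 2 / 2 : ℝ≥0))) with hd
  have hdpos : 0 < d := mul_pos (inv_pos.2 (Real.sqrt_pos.2 (by positivity))) (Real.exp_pos _)
  refine ⟨d ^ 2, by positivity, fun t ht ht1 => ?_⟩
  -- The square with half side `√t / 2` lies in the disk.
  have hs0 := Real.sqrt_nonneg t
  have hs1 : Real.sqrt t ≤ 1 := Real.sqrt_le_one.2 ht1
  have hs2 := Real.sq_sqrt ht
  have hsub : Set.Icc (-(Real.sqrt t / 2)) (Real.sqrt t / 2) ×ℂ
      Set.Icc (-(Real.sqrt t / 2)) (Real.sqrt t / 2) ⊆ {z : ℂ | ‖z‖ ^ 2 ≤ t} := by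
    rintro z ⟨hre, him⟩
    have h1 : z.re ^ 2 ≤ (Real.sqrt t / 2) ^ 2 := sq_le_sq' hre.1 hre.2
    have h2 : z.im ^ 2 ≤ (Real.sqrt t / 2) ^ 2 := sq_le_sq' him.1 him.2
    show ‖z‖ ^ 2 ≤ t
    rw [Complex.sq_norm, Complex.normSq_apply]
    nlinarith
  refine le_trans ?_ (measureReal_mono hsub)
  rw [complexNormal_real_reProdIm σ measurableSet_Icc measurableSet_Icc]
  have h1 := le_gaussianReal_Icc hv (M := 1) (a := -(Real.sqrt t / 2)) (b := Real.sqrt t / 2)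
    (by linarith) (by linarith) (by linarith)
  refine le_trans (le_of_eq ?_) (mul_le_mul h1 h1 ?_ measureReal_nonneg)
  · rw [← hd]
    linear_combination -d ^ 2 * hs2
  · exact mul_nonneg hdpos.le (by linarith)

theorem complexNormal_one_le_norm_pos {σ : ℝ≥0} (hσ : 0 < σ) :
    0 < (complexNormal σ).real {z | 1 ≤ ‖z‖} := by
  have hv : σ ^ 2 / 2 ≠ 0 := (by positivity : 0 < σ ^ 2 / 2).ne'
  have hv' : (0 : ℝ) < (σ ^ 2 / 2 : ℝ≥0) := NNReal.coe_pos.2 (by positivity)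
  have hsub : Set.Icc (1 : ℝ) 2 ×ℂ Set.Icc (1 : ℝ) 2 ⊆ {z : ℂ | 1 ≤ ‖z‖} := fun z hz =>
    hz.1.1.trans ((le_abs_self _).trans (Complex.abs_re_le_norm z))
  refine lt_of_lt_of_le ?_ (measureReal_mono hsub)
  rw [complexNormal_real_reProdIm σ measurableSet_Icc measurableSet_Icc]
  have h1 := le_gaussianReal_Icc hv (M := 2) (a := 1) (b := 2)
    (by norm_num) (by norm_num) (by norm_num)
  have h2 : 0 < (gaussianReal 0 (σ ^ 2 / 2)).real (Set.Icc 1 2) := by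
    refine lt_of_lt_of_le ?_ h1
    have : 0 < Real.sqrt (2 * Real.pi * (σ ^ 2 / 2 : ℝ≥0)) := Real.sqrt_pos.2 (by positivity)
    have := Real.exp_pos (-2 ^ 2 / (2 * (σ ^ 2 / 2 : ℝ≥0)))
    have : (2 : ℝ) - 1 = 1 := by norm_num
    rw [this]
    positivity
  exact mul_pos h2 h2

/-! ### The symbol error rate as an integral -/

namespace RelayNetwork

variable {R : ℕ} (N : RelayNetwork R)

instance : IsProbabilityMeasure N.channelLaw := by
  unfold channelLaw
  infer_instance

theorem continuous_rho {P : ℝ} (hP : 0 < P) (r : Fin R) :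
    Continuous fun h : ChannelState R => N.rho P h r := by
  have h2 := N.p₀_pos
  unfold rho
  refine Continuous.div (by fun_prop) (by fun_prop) fun h => ?_
  positivity

theorem continuous_snr_channel {P : ℝ} (hP : 0 < P) (x : BeamVec R) :
    Continuous fun h : ChannelState R => N.snr P x h := by
  have hr := fun r => N.continuous_rho hP r
  unfold snr
  refine Continuous.div (by fun_prop) (by fun_prop) fun h => ?_
  have : 0 ≤ ∑ r, ‖x r‖ ^ 2 * ‖(h r).2‖ ^ 2 * N.rho P h r :=
    Finset.sum_nonneg fun r _ => mul_nonneg (by positivity) (N.rho_nonneg hP h r)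
  linarith

/-- The attained SNR is measurable whatever tie-breaking the quantizer uses: it is the supremum of
the continuous functions `SNR_P(x, ·)`, `x ∈ C`, so its superlevel sets are open. -/
theorem measurable_snr_bestQuantizer {P : ℝ} (hP : 0 < P) {C : Set (BeamVec R)}
    (hC : IsCodebook C) : Measurable fun h => N.snr P (N.bestQuantizer P C h) h := by
  refine measurable_of_Ioi fun a => IsOpen.measurableSet ?_
  have h1 : (fun h => N.snr P (N.bestQuantizer P C h) h) ⁻¹' Set.Ioi a =
      ⋃ x ∈ C, {h | a < N.snr P x h} := by
    ext h
    have hb := N.isBest_bestQuantizer hP hC.isCompact hC.nonempty h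
    simp only [Set.mem_preimage, Set.mem_Ioi, Set.mem_iUnion, Set.mem_ofPred_eq, exists_prop]
    exact ⟨fun hh => ⟨_, hb.1, hh⟩, fun ⟨x, hx, hh⟩ => hh.trans_le (hb.2 x hx)⟩
  rw [h1]
  exact isOpen_biUnion fun x _ => isOpen_lt continuous_const (N.continuous_snr_channel hP x)

theorem integrable_ser {P : ℝ} (hP : 0 < P) {C : Set (BeamVec R)} (hC : IsCodebook C) :
    Integrable (fun h => gaussianQ (Real.sqrt (2 * N.snr P (N.bestQuantizer P C h) h)))
      N.channelLaw := by
  refine Integrable.of_bound (C := 2) ?_ (ae_of_all _ fun h => ?_)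
  · exact (gaussianQ_antitone.measurable.comp
      ((N.measurable_snr_bestQuantizer hP hC).const_mul 2).sqrt).aestronglyMeasurable
  · rw [Real.norm_of_nonneg (gaussianQ_nonneg _)]
    exact gaussianQ_le_two (Real.sqrt_nonneg _)

theorem le_SER_of_snr_le {P : ℝ} (hP : 0 < P) {C : Set (BeamVec R)} (hC : IsCodebook C)
    {S : Set (ChannelState R)} (hS : MeasurableSet S) {s : ℝ}
    (h : ∀ h ∈ S, ∀ x ∈ C, N.snr P x h ≤ s) :
    gaussianQ (Real.sqrt (2 * s)) * N.channelLaw.real S ≤ N.SER P C := by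
  have hint := N.integrable_ser hP hC
  calc gaussianQ (Real.sqrt (2 * s)) * N.channelLaw.real S
      = ∫ _ in S, gaussianQ (Real.sqrt (2 * s)) ∂N.channelLaw := by simp [mul_comm]
    _ ≤ ∫ h in S, gaussianQ (Real.sqrt (2 * N.snr P (N.bestQuantizer P C h) h))
          ∂N.channelLaw := by
        refine setIntegral_mono_on (by simp) hint.integrableOn hS fun h' hh' => ?_
        refine gaussianQ_antitone (Real.sqrt_le_sqrt ?_)
        have := h h' hh' _ (N.isBest_bestQuantizer hP hC.isCompact hC.nonempty h').1
        linarith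
    _ ≤ N.SER P C := setIntegral_le_integral hint (ae_of_all _ fun h => gaussianQ_nonneg _)

theorem SER_le_of_le_snr {P : ℝ} (hP : 0 < P) {C : Set (BeamVec R)} (hC : IsCodebook C)
    {S : Set (ChannelState R)} (hS : MeasurableSet S) {s : ℝ} (hs : 0 ≤ s)
    (h : ∀ h ∉ S, ∃ x ∈ C, s ≤ N.snr P x h) :
    N.SER P C ≤ 2 * Real.exp (-s / 2) + 2 * N.channelLaw.real S := by
  have hind : Integrable (S.indicator fun _ => (2 : ℝ)) N.channelLaw :=
    (integrable_const _).indicator hS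
  calc N.SER P C ≤ ∫ h, (2 * Real.exp (-s / 2) + S.indicator (fun _ => (2 : ℝ)) h)
        ∂N.channelLaw := by
        refine integral_mono (N.integrable_ser hP hC) ((integrable_const _).add hind) fun h' => ?_
        by_cases hh' : h' ∈ S
        · simp only [Set.indicator_of_mem hh']
          have := gaussianQ_le_two (Real.sqrt_nonneg (2 * N.snr P (N.bestQuantizer P C h') h'))
          linarith [Real.exp_pos (-s / 2)]
        · simp only [Set.indicator_of_notMem hh', add_zero]
          obtain ⟨x, hx, hsx⟩ := h h' hh'
          have hb := hsx.trans ((N.isBest_bestQuantizer hP hC.isCompact hC.nonempty h').2 x hx)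
          refine (gaussianQ_antitone (Real.sqrt_le_sqrt (by linarith :
            2 * s ≤ 2 * N.snr P (N.bestQuantizer P C h') h'))).trans ?_
          refine (gaussianQ_le (Real.sqrt_nonneg _)).trans_eq ?_
          rw [Real.sq_sqrt (by linarith)]
          congr 2
          ring
    _ = 2 * Real.exp (-s / 2) + 2 * N.channelLaw.real S := by
        rw [integral_add (integrable_const _) hind, integral_indicator hS]
        simp [mul_comm]

end RelayNetwork

/-! ### Lower bound on the error rate without near-selection vectors -/

namespace RelayNetwork

variable {R : ℕ} (N : RelayNetwork R)

theorem channelLaw_real_pi (s : Fin R → Set (ℂ × ℂ)) :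
    N.channelLaw.real (Set.univ.pi s) =
      ∏ r, ((complexNormal (N.σf r)).prod (complexNormal (N.σg r))).real (s r) := by
  rw [measureReal_def, channelLaw, Measure.pi_pi, ENNReal.toReal_prod]
  rfl

/-- The channel states in which every relay `q ≠ r` has a weak first hop, `|f_q|² ≤ 1 / P`, but a
strong second hop, so that it mostly forwards noise, while `|g_r| ≤ 1`. -/
def noisyEvent (r : Fin R) (P : ℝ) : Set (ChannelState R) :=
  Set.univ.pi fun q => if q = r then Set.univ ×ˢ {z : ℂ | ‖z‖ ^ 2 ≤ 1}
    else {z : ℂ | ‖z‖ ^ 2 ≤ P⁻¹} ×ˢ {z : ℂ | 1 ≤ ‖z‖}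

theorem measurableSet_noisyEvent (r : Fin R) (P : ℝ) : MeasurableSet (noisyEvent r P) := by
  refine MeasurableSet.univ_pi fun q => ?_
  split_ifs
  · exact MeasurableSet.univ.prod (measurableSet_le (by fun_prop) (by fun_prop))
  · exact (measurableSet_le (by fun_prop) (by fun_prop)).prod
      (measurableSet_le (by fun_prop) (by fun_prop))

theorem noisyEvent_prob : ∃ c : ℝ, 0 < c ∧ ∀ (r : Fin R) (P : ℝ), 1 ≤ P →
    c * P⁻¹ ^ (R - 1) ≤ N.channelLaw.real (noisyEvent r P) := by
  choose kf hkf hf using fun q => le_complexNormal_disk (N.σf_pos q)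
  choose kg hkg hg using fun q => le_complexNormal_disk (N.σg_pos q)
  have ha := fun q => complexNormal_one_le_norm_pos (N.σg_pos q)
  set a : Fin R → ℝ := fun q => min (kg q) (kf q * (complexNormal (N.σg q)).real {z | 1 ≤ ‖z‖})
  have hapos : ∀ q, 0 < a q := fun q => lt_min (hkg q) (mul_pos (hkf q) (ha q))
  refine ⟨∏ q, a q, Finset.prod_pos fun q _ => hapos q, fun r P hP => ?_⟩
  have hP0 : 0 < P := by linarith
  have h1 : P⁻¹ ^ (R - 1) = ∏ q : Fin R, if q = r then 1 else P⁻¹ := by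
    rw [Finset.prod_ite, Finset.prod_const_one, one_mul, Finset.prod_const,
      Finset.filter_not, Finset.filter_eq' Finset.univ r]
    simp [Finset.card_sdiff]
  rw [noisyEvent, channelLaw_real_pi, h1, ← Finset.prod_mul_distrib]
  refine Finset.prod_le_prod (fun q _ => ?_) fun q _ => ?_
  · have := hapos q
    split_ifs <;> positivity
  · split_ifs with hq
    · rw [measureReal_prod_prod]
      have := hg q 1 (by norm_num) le_rfl
      simp only [mul_one, probReal_univ, one_mul] at this ⊢
      exact (min_le_left _ _).trans this
    · rw [measureReal_prod_prod]
      have h2 := hf q P⁻¹ (by positivity) (inv_le_one_of_one_le₀ hP)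
      calc a q * P⁻¹ ≤ kf q * (complexNormal (N.σg q)).real {z | 1 ≤ ‖z‖} * P⁻¹ := by
            gcongr
            exact min_le_right _ _
        _ = kf q * P⁻¹ * (complexNormal (N.σg q)).real {z | 1 ≤ ‖z‖} := by ring
        _ ≤ _ := by gcongr

/-- A bound for the ratios `p_r (1 + p₀) / p_q`. -/
noncomputable def kappa : ℝ := (∑ r, N.p r) * (∑ q, (N.p q)⁻¹) * (1 + N.p₀)

theorem kappa_nonneg : 0 ≤ N.kappa := by
  have := N.p₀_pos
  exact mul_nonneg (mul_nonneg (Finset.sum_nonneg fun r _ => (N.p_pos r).le)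
    (Finset.sum_nonneg fun r _ => (inv_pos.2 (N.p_pos r)).le)) (by linarith)

theorem le_kappa_mul (r q : Fin R) : N.p r * (1 + N.p₀) ≤ N.kappa * N.p q := by
  have h0 := N.p₀_pos
  have hq := N.p_pos q
  have h1 : N.p r ≤ ∑ r, N.p r :=
    Finset.single_le_sum (fun i _ => (N.p_pos i).le) (Finset.mem_univ r)
  have h2 : (N.p q)⁻¹ ≤ ∑ q, (N.p q)⁻¹ :=
    Finset.single_le_sum (f := fun q => (N.p q)⁻¹) (fun i _ => (inv_pos.2 (N.p_pos i)).le)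
      (Finset.mem_univ q)
  have h3 : 1 ≤ (∑ q, (N.p q)⁻¹) * N.p q := by
    calc 1 = (N.p q)⁻¹ * N.p q := by field_simp
      _ ≤ _ := by gcongr
  have h4 := (N.p_pos r).le.trans h1
  unfold kappa
  calc N.p r * (1 + N.p₀) ≤ (∑ r, N.p r) * 1 * (1 + N.p₀) := by rw [mul_one]; gcongr
    _ ≤ (∑ r, N.p r) * ((∑ q, (N.p q)⁻¹) * N.p q) * (1 + N.p₀) := by gcongr
    _ = _ := by ring

/-- On `noisyEvent r P`, a beamforming vector with `|x_q|² ≥ δ` for some `q ≠ r` forwards so much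
noise that its SNR is at most of order `1 / δ`. -/
theorem snr_le_of_mem_noisyEvent {P δ : ℝ} (hP : 0 < P) (hδ : 0 < δ) {r q : Fin R}
    {h : ChannelState R} (hh : h ∈ noisyEvent r P) {x : BeamVec R} (hx : ‖x.ofLp‖ ≤ 1)
    (hqr : q ≠ r) (hxq : δ ≤ ‖x q‖ ^ 2) :
    N.snr P x h ≤ R ^ 2 * (N.p₀ + N.kappa / δ) := by
  have hp0 := N.p₀_pos
  have hκ := N.kappa_nonneg
  have hrho := fun k => N.rho_nonneg hP h k
  have hweak : ∀ k, k ≠ r → ‖(h k).1‖ ^ 2 ≤ P⁻¹ ∧ 1 ≤ ‖(h k).2‖ := fun k hk => by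
    have := hh k (Set.mem_univ k)
    simp only [if_neg hk] at this
    exact this
  have hgr : ‖(h r).2‖ ^ 2 ≤ 1 := by
    have := hh r (Set.mem_univ r)
    simp only [if_true] at this
    exact this.2
  set d : Fin R → ℝ := fun k => ‖x k‖ ^ 2 * ‖(h k).2‖ ^ 2 * N.rho P h k with hd
  have hd0 : ∀ k, 0 ≤ d k := fun k => mul_nonneg (by positivity) (hrho k)
  set Den : ℝ := 1 + ∑ k, d k with hDen
  have hDpos : 0 < Den := by
    have := Finset.sum_nonneg fun k (_ : k ∈ Finset.univ) => hd0 k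
    linarith
  have hdD : ∀ k, d k ≤ Den := fun k => by
    have := Finset.single_le_sum (fun i _ => hd0 i) (Finset.mem_univ k)
    linarith
  -- The noise forwarded by relay `q` alone is at least `δ p_q P / (1 + p₀)`.
  have hq : δ * (N.p q * P) ≤ (1 + N.p₀) * Den := by
    have h1 := hweak q hqr
    have h2 : N.p q * P / (1 + N.p₀) ≤ N.rho P h q := by
      unfold rho
      have := N.p_pos q
      gcongr
      calc ‖(h q).1‖ ^ 2 * (N.p₀ * P) ≤ P⁻¹ * (N.p₀ * P) := by gcongr; exact h1.1
        _ = N.p₀ := by field_simp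
    have h3 : δ * 1 * (N.p q * P / (1 + N.p₀)) ≤ d q := by
      have := N.p_pos q
      have h4 : 1 ≤ ‖(h q).2‖ ^ 2 := one_le_pow₀ h1.2
      simp only [hd]
      gcongr
    have h5 := h3.trans (hdD q)
    rw [mul_one, ← mul_div_assoc, div_le_iff₀ (by linarith)] at h5
    linarith
  have hterm : ∀ k, N.p₀ * P * ‖(h k).1‖ ^ 2 * d k ≤ (N.p₀ + N.kappa / δ) * Den := fun k => by
    by_cases hk : k = r
    · subst hk
      have hxk : ‖x k‖ ^ 2 ≤ 1 := by
        have : ‖x.ofLp k‖ ≤ 1 := (norm_le_pi_norm _ _).trans hx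
        exact pow_le_one₀ (norm_nonneg _) this
      have h1 : N.p₀ * P * ‖(h k).1‖ ^ 2 * N.rho P h k ≤ N.p k * P := by
        unfold rho
        have := N.p_pos k
        rw [← mul_div_assoc, div_le_iff₀ (by positivity)]
        nlinarith [mul_pos this hP]
      have h2 : N.p₀ * P * ‖(h k).1‖ ^ 2 * d k ≤ N.p k * P := by
        have h3 : ‖x k‖ ^ 2 * ‖(h k).2‖ ^ 2 ≤ 1 := mul_le_one₀ hxk (by positivity) hgr
        have h4 : 0 ≤ N.p₀ * P * ‖(h k).1‖ ^ 2 * N.rho P h k := mul_nonneg (by positivity) (hrho k)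
        calc _ = N.p₀ * P * ‖(h k).1‖ ^ 2 * N.rho P h k * (‖x k‖ ^ 2 * ‖(h k).2‖ ^ 2) := by
              simp only [hd]; ring
          _ ≤ _ := (mul_le_of_le_one_right h4 h3).trans h1
      have h5 : N.p k * P ≤ N.kappa / δ * Den := by
        rw [div_mul_eq_mul_div, le_div_iff₀ hδ]
        have h6 := mul_le_mul_of_nonneg_right (N.le_kappa_mul k q) (mul_pos hP hδ).le
        have h7 := mul_le_mul_of_nonneg_left hq hκ
        have h8 : N.p k * P * δ * (1 + N.p₀) ≤ N.kappa * Den * (1 + N.p₀) := by nlinarith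
        exact le_of_mul_le_mul_right h8 (by linarith)
      nlinarith
    · have h1 : N.p₀ * P * ‖(h k).1‖ ^ 2 ≤ N.p₀ := by
        calc N.p₀ * P * ‖(h k).1‖ ^ 2 ≤ N.p₀ * P * P⁻¹ := by gcongr; exact (hweak k hk).1
          _ = N.p₀ := by field_simp
      have h2 := mul_le_mul h1 (hdD k) (hd0 k) hp0.le
      have h3 : 0 ≤ N.kappa / δ * Den := by positivity
      linarith
  have hnum : ‖∑ k, x k * (h k).1 * (h k).2 * (Real.sqrt (N.rho P h k) : ℂ)‖ ^ 2 ≤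
      R * ∑ k, ‖(h k).1‖ ^ 2 * d k := by
    calc _ ≤ (∑ k, ‖x k * (h k).1 * (h k).2 * (Real.sqrt (N.rho P h k) : ℂ)‖) ^ 2 := by
          gcongr
          exact norm_sum_le _ _
      _ ≤ R * ∑ k, ‖x k * (h k).1 * (h k).2 * (Real.sqrt (N.rho P h k) : ℂ)‖ ^ 2 := by
          simpa using sq_sum_le_card_mul_sum_sq (s := Finset.univ)
            (f := fun k => ‖x k * (h k).1 * (h k).2 * (Real.sqrt (N.rho P h k) : ℂ)‖)
      _ = _ := by
          congr 1
          refine Finset.sum_congr rfl fun k _ => ?_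
          simp only [norm_mul, mul_pow, Complex.norm_real, hd]
          rw [Real.norm_of_nonneg (Real.sqrt_nonneg _), Real.sq_sqrt (hrho k)]
          ring
  show N.p₀ * P * ‖∑ k, x k * (h k).1 * (h k).2 * (Real.sqrt (N.rho P h k) : ℂ)‖ ^ 2 / Den ≤ _
  rw [div_le_iff₀ hDpos]
  calc _ ≤ N.p₀ * P * (R * ∑ k, ‖(h k).1‖ ^ 2 * d k) := by gcongr
    _ = R * ∑ k, N.p₀ * P * ‖(h k).1‖ ^ 2 * d k := by
        rw [Finset.mul_sum, Finset.mul_sum, Finset.mul_sum]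
        exact Finset.sum_congr rfl fun k _ => by ring
    _ ≤ R * ∑ _k : Fin R, (N.p₀ + N.kappa / δ) * Den := by
        exact mul_le_mul_of_nonneg_left (Finset.sum_le_sum fun k _ => hterm k) (Nat.cast_nonneg R)
    _ = _ := by
        simp
        ring

/-- If every vector of a codebook has some component off `r` of squared modulus above `C / log P`,
the error rate decays no faster than `P ^ (-R + 1/2)`: on `noisyEvent r P`, of probability of order
`P ^ (-(R - 1))`, the SNR is at most `(log P) / 4` up to a constant. -/
theorem le_SER_of_forall_exists : ∃ C : ℝ, 0 < C ∧ ∃ c : ℝ, 0 < c ∧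
    ∀ P : ℝ, 1 < P → ∀ B : Set (BeamVec R), IsCodebook B →
      ∀ r : Fin R, (∀ x ∈ B, ∃ q, q ≠ r ∧ C / Real.log P < ‖x q‖ ^ 2) →
        c * P ^ (-(R : ℝ) + 1 / 2) ≤ N.SER P B := by
  obtain ⟨c₁, hc₁, hprob⟩ := N.noisyEvent_prob
  have hκ := N.kappa_nonneg
  have hp0 := N.p₀_pos
  set c₂ : ℝ := (Real.sqrt (2 * Real.pi))⁻¹ * Real.exp (-1 - 2 * R ^ 2 * N.p₀) with hc₂
  have hc₂pos : 0 < c₂ :=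
    mul_pos (inv_pos.2 (Real.sqrt_pos.2 (by positivity))) (Real.exp_pos _)
  refine ⟨4 * R ^ 2 * N.kappa + 1, by positivity, c₂ * c₁, by positivity,
    fun P hP B hB r hr => ?_⟩
  have hP0 : 0 < P := by linarith
  have hlog : 0 < Real.log P := Real.log_pos hP
  set C : ℝ := 4 * R ^ 2 * N.kappa + 1 with hC
  have hCpos : 0 < C := by positivity
  set s : ℝ := R ^ 2 * (N.p₀ + N.kappa / (C / Real.log P)) with hs
  have hs0 : 0 ≤ s := by positivity
  have h1 := N.le_SER_of_snr_le hP0 hB (measurableSet_noisyEvent r P) (s := s)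
    fun h hh x hx => by
      obtain ⟨q, hqr, hq⟩ := hr x hx
      exact N.snr_le_of_mem_noisyEvent hP0 (by positivity) hh (hB.norm_eq_one x hx).le hqr hq.le
  have h2 : 2 * s ≤ 2 * R ^ 2 * N.p₀ + 1 / 2 * Real.log P := by
    have h3 : 4 * R ^ 2 * N.kappa / C ≤ 1 := by
      rw [div_le_one hCpos]
      linarith
    have h4 : 2 * s = 2 * R ^ 2 * N.p₀ + 1 / 2 * (4 * R ^ 2 * N.kappa / C) * Real.log P := by
      rw [hs]
      field_simp
      ring
    rw [h4]
    gcongr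
    linarith
  have h5 : c₂ * P ^ (-(1 / 2) : ℝ) ≤ gaussianQ (Real.sqrt (2 * s)) := by
    refine le_trans ?_ (le_gaussianQ (Real.sqrt_nonneg _))
    rw [Real.sq_sqrt (by positivity), Real.rpow_def_of_pos hP0, hc₂, mul_assoc, ← Real.exp_add]
    gcongr
    linarith
  have hR : 1 ≤ R := Fin.pos r
  have h6 : P ^ (-(R : ℝ) + 1 / 2) = P ^ (-(1 / 2) : ℝ) * P⁻¹ ^ (R - 1) := by
    rw [← Real.rpow_natCast, Real.inv_rpow hP0.le, ← Real.rpow_neg hP0.le, ← Real.rpow_add hP0]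
    congr 1
    push_cast [hR]
    ring
  calc c₂ * c₁ * P ^ (-(R : ℝ) + 1 / 2) =
        (c₂ * P ^ (-(1 / 2) : ℝ)) * (c₁ * P⁻¹ ^ (R - 1)) := by rw [h6]; ring
    _ ≤ gaussianQ (Real.sqrt (2 * s)) * N.channelLaw.real (noisyEvent r P) :=
        mul_le_mul h5 (hprob r P hP.le) (by positivity) (gaussianQ_nonneg _)
    _ ≤ N.SER P B := h1

end RelayNetwork

/-! ### Upper bound on the error rate of relay selection -/

namespace RelayNetwork

variable {R : ℕ} (N : RelayNetwork R)

theorem snr_single {P : ℝ} (hP : 0 < P) (r : Fin R) (h : ChannelState R) :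
    N.snr P (EuclideanSpace.single r 1) h =
      (N.p₀ * P * ‖(h r).1‖ ^ 2) * (N.p r * P * ‖(h r).2‖ ^ 2) /
        (1 + N.p₀ * P * ‖(h r).1‖ ^ 2 + N.p r * P * ‖(h r).2‖ ^ 2) := by
  have h0 := N.p₀_pos
  have h1 := N.p_pos r
  have hrho := N.rho_nonneg hP h r
  have hnum : ∑ k, (EuclideanSpace.single r (1 : ℂ) : BeamVec R) k * (h k).1 * (h k).2 *
      (Real.sqrt (N.rho P h k) : ℂ) = (h r).1 * (h r).2 * (Real.sqrt (N.rho P h r) : ℂ) := by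
    rw [Finset.sum_eq_single r (fun k _ hk => by simp [hk]) (by simp)]
    simp
  have hden : ∑ k, ‖(EuclideanSpace.single r (1 : ℂ) : BeamVec R) k‖ ^ 2 * ‖(h k).2‖ ^ 2 *
      N.rho P h k = ‖(h r).2‖ ^ 2 * N.rho P h r := by
    rw [Finset.sum_eq_single r (fun k _ hk => by simp [hk]) (by simp)]
    simp
  rw [snr, hnum, hden]
  simp only [norm_mul, mul_pow, Complex.norm_real]
  rw [Real.norm_of_nonneg (Real.sqrt_nonneg _), Real.sq_sqrt hrho, rho]
  field_simp

theorem le_snr_single {P m : ℝ} (hP : 0 < P) (hm : 1 ≤ m) {r : Fin R} {h : ChannelState R}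
    (hf : m ≤ N.p₀ * P * ‖(h r).1‖ ^ 2) (hg : m ≤ N.p r * P * ‖(h r).2‖ ^ 2) :
    m / 3 ≤ N.snr P (EuclideanSpace.single r 1) h := by
  rw [N.snr_single hP]
  set a := N.p₀ * P * ‖(h r).1‖ ^ 2
  set b := N.p r * P * ‖(h r).2‖ ^ 2
  rw [div_le_div_iff₀ (by norm_num) (by linarith)]
  nlinarith [mul_nonneg (sub_nonneg.2 hf) (by linarith : 0 ≤ b),
    mul_nonneg (sub_nonneg.2 hg) (by linarith : 0 ≤ a), mul_nonneg (sub_nonneg.2 hm)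
    (by linarith : 0 ≤ b)]

/-- The channel states in which every relay has a hop of squared gain at most `t`. -/
def weakEvent (R : ℕ) (t : ℝ) : Set (ChannelState R) :=
  Set.univ.pi fun _ =>
    {z : ℂ | ‖z‖ ^ 2 ≤ t} ×ˢ Set.univ ∪ Set.univ ×ˢ {z : ℂ | ‖z‖ ^ 2 ≤ t}

theorem measurableSet_weakEvent (t : ℝ) : MeasurableSet (weakEvent R t) :=
  MeasurableSet.univ_pi fun _ =>
    ((measurableSet_le (by fun_prop) (by fun_prop)).prod MeasurableSet.univ).union
      (MeasurableSet.univ.prod (measurableSet_le (by fun_prop) (by fun_prop)))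

theorem weakEvent_prob : ∃ K : ℝ, 0 < K ∧ ∀ t : ℝ, 0 ≤ t →
    N.channelLaw.real (weakEvent R t) ≤ K * t ^ R := by
  choose Kf hKf hf using fun q => complexNormal_disk_le (N.σf_pos q)
  choose Kg hKg hg using fun q => complexNormal_disk_le (N.σg_pos q)
  refine ⟨∏ q, (Kf q + Kg q), Finset.prod_pos fun q _ => add_pos (hKf q) (hKg q),
    fun t ht => ?_⟩
  have h1 : t ^ R = ∏ _q : Fin R, t := by simp
  rw [h1, ← Finset.prod_mul_distrib, weakEvent, channelLaw_real_pi]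
  refine Finset.prod_le_prod (fun q _ => measureReal_nonneg) fun q _ => ?_
  refine (measureReal_union_le _ _).trans ?_
  rw [measureReal_prod_prod, measureReal_prod_prod, add_mul]
  simp only [probReal_univ, mul_one, one_mul]
  exact add_le_add (hf q t ht) (hg q t ht)

/-- A codebook that contains the relay selection vectors has error rate of order at most
`(log P / P) ^ R`: for large `A`, the SNR of the best selection vector exceeds `2 R log P` unless
every relay has a hop of squared gain at most `A log P / P`. -/
theorem SER_le_of_single_mem : ∃ K : ℝ, 0 < K ∧ ∀ P : ℝ, Real.exp 1 ≤ P →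
    ∀ B : Set (BeamVec R), IsCodebook B → (∀ r, EuclideanSpace.single r 1 ∈ B) →
      N.SER P B ≤ K * (Real.log P ^ R * P ^ (-(R : ℝ))) := by
  obtain ⟨K, hK, hprob⟩ := N.weakEvent_prob
  have hp0 := N.p₀_pos
  set A : ℝ := (6 * R + 1) * ((N.p₀)⁻¹ + ∑ r, (N.p r)⁻¹) with hA
  have hsum : 0 ≤ ∑ r, (N.p r)⁻¹ := Finset.sum_nonneg fun r _ => (inv_pos.2 (N.p_pos r)).le
  have hApos : 0 < A := by positivity
  have hA0 : 6 * R + 1 ≤ N.p₀ * A := by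
    have h1 : N.p₀ * A = (6 * R + 1) + (6 * R + 1) * N.p₀ * ∑ r, (N.p r)⁻¹ := by
      rw [hA]
      field_simp
    rw [h1]
    have : 0 ≤ (6 * R + 1) * N.p₀ * ∑ r, (N.p r)⁻¹ := by positivity
    linarith
  have hAr : ∀ r, 6 * R + 1 ≤ N.p r * A := fun r => by
    have hr := N.p_pos r
    have h2 : (N.p r)⁻¹ ≤ ∑ q, (N.p q)⁻¹ :=
      Finset.single_le_sum (f := fun q => (N.p q)⁻¹) (fun i _ => (inv_pos.2 (N.p_pos i)).le)
        (Finset.mem_univ r)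
    have h3 : 0 < (N.p₀)⁻¹ := inv_pos.2 hp0
    calc (6 * R + 1 : ℝ) = N.p r * ((6 * R + 1) * (N.p r)⁻¹) := by field_simp
      _ ≤ N.p r * A := by
        rw [hA]
        gcongr
        linarith
  refine ⟨2 + 2 * (K * A ^ R), by positivity, fun P hP B hB hmem => ?_⟩
  have hP0 : 0 < P := (Real.exp_pos 1).trans_le hP
  have hlog : 1 ≤ Real.log P := (Real.le_log_iff_exp_le hP0).2 hP
  have hlog0 : 0 ≤ Real.log P := by linarith
  set t : ℝ := A * Real.log P / P with ht
  have ht0 : 0 ≤ t := by positivity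
  have hPt : P * t = A * Real.log P := by
    rw [ht]
    field_simp
  have hstrong : ∀ {p u : ℝ}, 0 < p → 6 * R + 1 ≤ p * A → t < u →
      (6 * R + 1) * Real.log P ≤ p * P * u := fun {p u} hp hpA hu => by
    calc (6 * R + 1) * Real.log P ≤ p * A * Real.log P := by gcongr
      _ = p * P * t := by rw [mul_assoc p P, hPt]; ring
      _ ≤ p * P * u := by gcongr
  have h1 := N.SER_le_of_le_snr hP0 hB (measurableSet_weakEvent t) (s := 2 * R * Real.log P)
    (by positivity) fun h hh => by
      simp only [weakEvent, Set.mem_pi, not_forall] at hh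
      obtain ⟨r, -, hr⟩ := hh
      simp only [Set.mem_union, Set.mem_prod, Set.mem_ofPred_eq, Set.mem_univ, and_true, true_and,
        not_or, not_le] at hr
      refine ⟨_, hmem r, le_trans ?_ (N.le_snr_single hP0 (m := (6 * R + 1) * Real.log P) ?_
        (hstrong hp0 hA0 hr.1) (hstrong (N.p_pos r) (hAr r) hr.2))⟩
      · linarith
      · exact one_le_mul_of_one_le_of_one_le (by linarith [Nat.cast_nonneg (α := ℝ) R]) hlog
  have h2 : Real.exp (-(2 * R * Real.log P) / 2) = P ^ (-(R : ℝ)) := by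
    rw [Real.rpow_def_of_pos hP0]
    congr 1
    ring
  have h3 : t ^ R = A ^ R * (Real.log P ^ R * P ^ (-(R : ℝ))) := by
    rw [Real.rpow_neg hP0.le, Real.rpow_natCast, ht, div_pow, mul_pow]
    ring
  have h4 := hprob t ht0
  rw [h3] at h4
  rw [h2] at h1
  have h5 : P ^ (-(R : ℝ)) ≤ Real.log P ^ R * P ^ (-(R : ℝ)) :=
    le_mul_of_one_le_left (by positivity) (one_le_pow₀ hlog)
  linarith

end RelayNetwork

/-! ### Codebooks containing the selection vectors -/

theorem isCodebook_sphere {R : ℕ} (hR : 0 < R) : IsCodebook {x : BeamVec R | ‖x.ofLp‖ = 1} where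
  nonempty := ⟨EuclideanSpace.single ⟨0, hR⟩ 1, by simp [Pi.norm_single]⟩
  isCompact := by
    have h := (isCompact_sphere (0 : Fin R → ℂ) 1).image
      (PiLp.continuous_toLp 2 fun _ : Fin R => ℂ)
    convert h using 1
    ext x
    constructor
    · exact fun hx => ⟨x.ofLp, by simpa using hx, rfl⟩
    · rintro ⟨y, hy, rfl⟩
      simpa using hy
  norm_eq_one _ hx := hx

theorem encard_range_single (R : ℕ) :
    (Set.range fun r : Fin R => (EuclideanSpace.single r 1 : BeamVec R)).encard = R := by
  have hinj : Function.Injective fun r : Fin R => (EuclideanSpace.single r 1 : BeamVec R) := by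
    intro r q hrq
    by_contra hne
    have := congrArg (fun x : BeamVec R => x r) hrq
    simp [hne] at this
  rw [← Set.image_univ, hinj.encard_image]
  simp

/-- Every cardinality from `R` on that some codebook has is that of a codebook containing the relay
selection vectors. -/
theorem exists_isCodebook_single_mem {R : ℕ} (hR : 0 < R) {n : ℕ∞} (hn : (R : ℕ∞) ≤ n)
    {B₀ : Set (BeamVec R)} (hB₀ : IsCodebook B₀) (hcard : B₀.encard = n) :
    ∃ B : Set (BeamVec R), IsCodebook B ∧ B.encard = n ∧ ∀ r, EuclideanSpace.single r 1 ∈ B := by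
  set X : Set (BeamVec R) := {x | ‖x.ofLp‖ = 1} with hX
  have hle : n ≤ X.encard := hcard ▸ Set.encard_le_encard fun x hx => hB₀.norm_eq_one x hx
  have hsub : (Set.range fun r : Fin R => (EuclideanSpace.single r 1 : BeamVec R)) ⊆ X := by
    rintro _ ⟨r, rfl⟩
    simp [hX, Pi.norm_single]
  by_cases htop : n = ⊤
  · exact ⟨X, isCodebook_sphere hR, by rw [htop] at hle ⊢; exact top_le_iff.1 hle,
      fun r => hsub ⟨r, rfl⟩⟩
  · obtain ⟨B, h1, h2, h3⟩ := Set.exists_superset_subset_encard_eq hsub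
      ((encard_range_single R).trans_le hn) hle
    have hfin : B.Finite := Set.encard_ne_top_iff.1 (h3.trans_ne htop)
    exact ⟨B, ⟨⟨_, h1 ⟨⟨0, hR⟩, rfl⟩⟩, hfin.isCompact, fun x hx => h2 hx⟩, h3,
      fun r => h1 ⟨r, rfl⟩⟩

/-! ### Near-selection vectors -/

namespace DCodebook

variable {R : ℕ} (D : DCodebook R)

theorem relays_pos (D : DCodebook R) : 0 < R := by
  rcases Nat.eq_zero_or_pos R with h | h
  · subst h
    obtain ⟨x, hx⟩ := (D.isCodebook 1 one_pos).nonempty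
    have h1 := (D.isCodebook 1 one_pos).norm_eq_one x hx
    rw [Subsingleton.elim x.ofLp 0, norm_zero] at h1
    exact absurd h1 zero_ne_one
  · exact h

theorem norm_apply_eq_one {x : BeamVec R} (hx : ‖x.ofLp‖ = 1) {r : Fin R} {c : ℝ} (hc : c < 1)
    (h : ∀ q, q ≠ r → ‖x q‖ ^ 2 ≤ c) : ‖x r‖ = 1 := by
  refine le_antisymm (hx ▸ norm_le_pi_norm x.ofLp r) ?_
  by_contra! hlt
  have : ‖x.ofLp‖ < 1 := by
    refine (pi_norm_lt_iff one_pos).2 fun q => ?_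
    by_cases hq : q = r
    · exact hq ▸ hlt
    · have h1 := h q hq
      nlinarith [norm_nonneg (x q)]
  exact this.ne hx

theorem hasNearSRS_of_forall_exists {P c : ℝ} (hP : 0 < P) (hc : c < 1)
    (h : ∀ r, ∃ x ∈ D.book P, ∀ q, q ≠ r → ‖x q‖ ^ 2 ≤ c) : D.HasNearSRS P c := by
  choose e he hq using h
  refine ⟨e, fun r s hrs => ?_, he, hq⟩
  by_contra hne
  have h1 := norm_apply_eq_one ((D.isCodebook P hP).norm_eq_one _ (he s)) hc (hq s)
  have h2 := hq r s (Ne.symm hne)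
  rw [hrs, h1] at h2
  linarith

theorem HasNearSRS.card_le {D : DCodebook R} {P c : ℝ} (hP : 0 < P) (h : D.HasNearSRS P c) :
    (R : ℕ∞) ≤ D.card := by
  obtain ⟨e, he, hmem, -⟩ := h
  rw [← D.encard_eq P hP]
  calc (R : ℕ∞) = (Set.range e).encard := by
        rw [← Set.image_univ, he.encard_image]
        simp
    _ ≤ _ := Set.encard_le_encard (Set.range_subset_iff.2 hmem)

/-! ### Limits of codebooks -/

theorem mem_upperLimit_of_frequently {x : BeamVec R}
    (h : ∀ ε > 0, ∃ᶠ P in atTop, Metric.infDist x (D.book P) ≤ ε) : x ∈ D.upperLimit := by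
  have hbdd : IsBoundedUnder (· ≥ ·) atTop fun P : ℝ => Metric.infDist x (D.book P) :=
    isBoundedUnder_of ⟨0, fun P => Metric.infDist_nonneg⟩
  refine le_antisymm (le_of_forall_pos_le_add fun ε hε => ?_) ?_
  · rw [zero_add]
    exact liminf_le_of_frequently_le (h ε hε) hbdd
  · exact le_liminf_of_le (IsCoboundedUnder.of_frequently_le (h 1 one_pos))
      (Eventually.of_forall fun P => Metric.infDist_nonneg)

/-- Along an ultrafilter finer than `atTop` the near-selection vectors converge to selection
vectors. These lie in the upper limit, and if `|D| = R` they exhaust the lower limit. -/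
theorem exists_srsCodebook_subset {C : ℝ}
    (h : ∀ᶠ P in atTop, D.HasNearSRS P (C / Real.log P)) :
    ∃ θ : Fin R → ℝ, srsCodebook θ ⊆ D.upperLimit ∧
      (D.card = R → D.lowerLimit ⊆ srsCodebook θ) := by
  have h' : ∀ P, ∃ e : Fin R → BeamVec R, D.HasNearSRS P (C / Real.log P) →
      Function.Injective e ∧ (∀ r, e r ∈ D.book P) ∧
        ∀ r q, q ≠ r → ‖e r q‖ ^ 2 ≤ C / Real.log P := fun P => by
    by_cases hP : D.HasNearSRS P (C / Real.log P)
    · exact ⟨hP.choose, fun _ => hP.choose_spec⟩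
    · exact ⟨0, fun h => absurd h hP⟩
  choose e he using h'
  have hC : Tendsto (fun P : ℝ => C / Real.log P) atTop (𝓝 0) :=
    Real.tendsto_log_atTop.const_div_atTop C
  set U : Ultrafilter ℝ := Ultrafilter.of atTop
  have hU : (U : Filter ℝ) ≤ atTop := Ultrafilter.of_le atTop
  have hspec : ∀ᶠ P in (U : Filter ℝ), 0 < P ∧ C / Real.log P < 1 ∧ Function.Injective (e P) ∧
      (∀ r, e P r ∈ D.book P) ∧ ∀ r q, q ≠ r → ‖e P r q‖ ^ 2 ≤ C / Real.log P := by
    refine hU ?_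
    filter_upwards [h, eventually_gt_atTop 0, hC.eventually_lt_const one_pos] with P h1 h2 h3
    exact ⟨h2, h3, he P h1⟩
  have hcirc : ∀ r, ∃ z : ℂ, ‖z‖ = 1 ∧ Tendsto (fun P => e P r r) U (𝓝 z) := fun r => by
    obtain ⟨z, hz, hle⟩ := (isCompact_sphere (0 : ℂ) 1).ultrafilter_le_nhds
      (U.map fun P => e P r r) (by
        rw [le_principal_iff, Ultrafilter.mem_coe, Ultrafilter.mem_map]
        refine hspec.mono fun P hP => ?_
        simpa using norm_apply_eq_one
          ((D.isCodebook P hP.1).norm_eq_one _ (hP.2.2.2.1 r)) hP.2.1 (hP.2.2.2.2 r))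
    exact ⟨z, by simpa using hz, hle⟩
  choose z hz hlim using hcirc
  choose θ hθ using fun r => (Complex.norm_eq_one_iff (z r)).1 (hz r)
  set v : Fin R → BeamVec R := fun r =>
    EuclideanSpace.single r (Complex.exp (θ r * Complex.I)) with hv
  have hconv : ∀ r, Tendsto (fun P => e P r) U (𝓝 (v r)) := fun r => by
    rw [(PiLp.homeomorph 2 fun _ : Fin R => ℂ).isInducing.tendsto_nhds_iff, tendsto_pi_nhds]
    intro q
    change Tendsto (fun P => e P r q) U (𝓝 (v r q))
    by_cases hq : q = r
    · subst hq
      simpa [hv, hθ] using hlim q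
    · have h0 : Tendsto (fun P => ‖e P r q‖ ^ 2) U (𝓝 0) :=
        squeeze_zero' (Eventually.of_forall fun P => by positivity)
          (by filter_upwards [hspec] with P hP using hP.2.2.2.2 r q hq) (hC.mono_left hU)
      have h1 : Tendsto (fun P => ‖e P r q‖) U (𝓝 0) := by
        simpa using h0.sqrt
      simpa [hv, hq] using tendsto_zero_iff_norm_tendsto_zero.2 h1
  refine ⟨θ, ?_, fun hcard x hx => ?_⟩
  · rintro _ ⟨r, rfl⟩
    refine D.mem_upperLimit_of_frequently fun ε hε => ?_
    refine Frequently.filter_mono (Eventually.frequently ?_) hU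
    filter_upwards [hspec, Metric.tendsto_nhds.1 (hconv r) ε hε] with P hP h1
    refine (Metric.infDist_le_dist_of_mem (hP.2.2.2.1 r)).trans ?_
    rw [dist_comm]
    exact h1.le
  · have hx' : Tendsto (fun P => Metric.infDist x (D.book P)) U (𝓝 0) :=
      Tendsto.mono_left hx hU
    -- When `|D| = R`, the nearest codeword is some `e P r`, with `r` constant along `U`.
    have hnear : ∀ᶠ P in (U : Filter ℝ), ∃ r, Metric.infDist x (D.book P) = dist x (e P r) := by
      filter_upwards [hspec] with P hP
      have hcb := D.isCodebook P hP.1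
      obtain ⟨y, hy, hxy⟩ := hcb.isCompact.exists_infDist_eq_dist hcb.nonempty x
      have hrange : Set.range (e P) = D.book P := by
        refine (Set.finite_range _).eq_of_subset_of_encard_le
          (Set.range_subset_iff.2 hP.2.2.2.1) ?_
        rw [D.encard_eq P hP.1, hcard, ← Set.image_univ, hP.2.2.1.encard_image]
        simp
      rw [← hrange] at hy
      obtain ⟨r, rfl⟩ := hy
      exact ⟨r, hxy⟩
    obtain ⟨r, hr⟩ := Ultrafilter.eventually_exists_iff.1 hnear
    refine ⟨r, ?_⟩
    have h1 : Tendsto (fun P => dist x (e P r)) U (𝓝 (dist x (v r))) :=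
      tendsto_const_nhds.dist (hconv r)
    exact (dist_eq_zero.1 (tendsto_nhds_unique h1 (hx'.congr' hr))).symm

end DCodebook

/-! ### Diversity forces near-selection vectors -/

namespace RelayNetwork

variable {R : ℕ} (N : RelayNetwork R)

theorem HasDiversity.eventually_SER_lt {N : RelayNetwork R} {D : DCodebook R}
    (hD : N.HasDiversity D R) {c : ℝ} (hc : 0 < c) :
    ∀ᶠ P in atTop, N.SER P (D.book P) < c * P ^ (-(R : ℝ) + 1 / 2) := by
  have h1 : ∀ᶠ P : ℝ in atTop,
      (R : ℝ) - 1 / 4 < -Real.log (N.SER P (D.book P)) / Real.log P :=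
    Tendsto.eventually_const_lt (by linarith) hD
  have h2 : ∀ᶠ P : ℝ in atTop, -(4 * Real.log c) ≤ Real.log P :=
    Real.tendsto_log_atTop.eventually_ge_atTop _
  filter_upwards [h1, h2, eventually_gt_atTop 1] with P h1 h2 hP
  by_contra! hle
  have hP0 : 0 < P := by linarith
  have hlog := Real.log_pos hP
  have h3 := Real.log_le_log (by positivity) hle
  rw [Real.log_mul hc.ne' (by positivity), Real.log_rpow hP0] at h3
  rw [lt_div_iff₀ hlog] at h1
  nlinarith

theorem eventually_log_pow_mul_rpow_lt (R : ℕ) (K : ℝ) {c : ℝ} (hc : 0 < c) (hK : 0 < K) :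
    ∀ᶠ P : ℝ in atTop,
      K * (Real.log P ^ R * P ^ (-(R : ℝ))) < c * P ^ (-(R : ℝ) + 1 / 2) := by
  have h1 := (isLittleO_log_rpow_rpow_atTop (s := 1 / 2) (R : ℝ) (by norm_num)).bound
    (show 0 < c / K / 2 by positivity)
  filter_upwards [h1, eventually_gt_atTop 1] with P h1 hP
  have hP0 : 0 < P := by linarith
  have hlog := Real.log_pos hP
  rw [Real.rpow_natCast, Real.norm_of_nonneg (by positivity),
    Real.norm_of_nonneg (by positivity)] at h1
  rw [Real.rpow_add hP0]
  have h2 : 0 < P ^ (-(R : ℝ)) := by positivity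
  have h3 : 0 < P ^ (1 / 2 : ℝ) := by positivity
  have h4 : K * Real.log P ^ R < c * P ^ (1 / 2 : ℝ) := by
    calc K * Real.log P ^ R ≤ K * (c / K / 2 * P ^ (1 / 2 : ℝ)) := by gcongr
      _ = c * P ^ (1 / 2 : ℝ) / 2 := by field_simp
      _ < _ := half_lt_self (by positivity)
  nlinarith

/-- Contrapositive of `le_SER_of_forall_exists`; the range `P > exp C` makes `C / log P < 1`, so
that near-selection vectors for different relays are distinct. -/
theorem exists_hasNearSRS_bounds : ∃ C : ℝ, 0 < C ∧ ∃ c : ℝ, 0 < c ∧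
    ∀ P : ℝ, Real.exp C < P → ∀ D : DCodebook R,
      N.SER P (D.book P) < c * P ^ (-(R : ℝ) + 1 / 2) → D.HasNearSRS P (C / Real.log P) := by
  obtain ⟨C, hC, c, hc, hlow⟩ := N.le_SER_of_forall_exists
  refine ⟨C, hC, c, hc, fun P hP D hlt => ?_⟩
  have hP1 : 1 < P := (Real.one_lt_exp_iff.2 hC).trans hP
  have hP0 : 0 < P := by linarith
  refine D.hasNearSRS_of_forall_exists hP0 ?_ fun r => ?_
  · rw [div_lt_one (Real.log_pos hP1)]
    exact (Real.lt_log_iff_exp_lt hP0).2 hP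
  · by_contra! hcon
    exact (hlow P hP1 _ (D.isCodebook P hP0) r hcon).not_gt hlt

end RelayNetwork

theorem theorem3 {R : ℕ} (N : RelayNetwork R) :
    ∃ C : ℝ, 0 < C ∧ ∃ P_opt : ℝ, 0 < P_opt ∧
      ∀ D : DCodebook R, N.HasDiversity D (R : ℝ) →
        (∃ P_D : ℝ, 0 < P_D ∧ ∀ P : ℝ, P_D < P → D.HasNearSRS P (C / Real.log P)) ∧
        (N.IsSEROptimal D → ∀ P : ℝ, P_opt < P → D.HasNearSRS P (C / Real.log P)) ∧
        (∀ L : Set (BeamVec R), D.HasLimit L →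
          (D.card = (R : ℕ∞) → ∃ θ : Fin R → ℝ, srsCodebook θ = L) ∧
          ((R : ℕ∞) < D.card → ∃ θ : Fin R → ℝ, srsCodebook θ ⊆ L)) ∧
        ((¬ ∃ L : Set (BeamVec R), D.HasLimit L) →
          ∃ θ : Fin R → ℝ, srsCodebook θ ⊆ D.upperLimit) := by
  obtain ⟨C, hC, c, hc, hnear⟩ := N.exists_hasNearSRS_bounds
  obtain ⟨K, hK, hup⟩ := N.SER_le_of_single_mem
  obtain ⟨P₀, hP₀⟩ := eventually_atTop.1
    (RelayNetwork.eventually_log_pow_mul_rpow_lt R K hc hK)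
  refine ⟨C, hC, max P₀ (max (Real.exp 1) (Real.exp C)),
    lt_max_of_lt_right (lt_max_of_lt_left (Real.exp_pos 1)), fun D hD => ?_⟩
  have hev : ∀ᶠ P in atTop, D.HasNearSRS P (C / Real.log P) := by
    filter_upwards [hD.eventually_SER_lt hc, eventually_gt_atTop (Real.exp C)] with P h1 h2
    exact hnear P h2 D h1
  obtain ⟨θ, hθ, hθ'⟩ := D.exists_srsCodebook_subset hev
  refine ⟨?_, fun hopt P hP => ?_, fun L hL => ⟨fun hcard => ⟨θ, ?_⟩, fun _ => ⟨θ, ?_⟩⟩,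
    fun _ => ⟨θ, hθ⟩⟩
  · obtain ⟨P₁, hP₁⟩ := eventually_atTop.1 hev
    exact ⟨max P₁ 1, lt_max_of_lt_right one_pos, fun P hP =>
      hP₁ P ((le_max_left _ _).trans hP.le)⟩
  · obtain ⟨hPP₀, hP2⟩ := max_lt_iff.1 hP
    obtain ⟨hP1, hPC⟩ := max_lt_iff.1 hP2
    have hP0 : 0 < P := (Real.exp_pos 1).trans hP1
    have hcard : (R : ℕ∞) ≤ D.card := by
      obtain ⟨Q, hQ, hQ0⟩ := (hev.and (eventually_gt_atTop 0)).exists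
      exact hQ.card_le hQ0
    obtain ⟨B, hB, hBcard, hBmem⟩ := exists_isCodebook_single_mem D.relays_pos hcard
      (D.isCodebook P hP0) (D.encard_eq P hP0)
    exact hnear P hPC D (((hopt P hP0 B hB hBcard).trans (hup P hP1.le B hB hBmem)).trans_lt
      (hP₀ P hPP₀.le))
  · exact (hL.2 ▸ hθ).antisymm (hL.1 ▸ hθ' hcard)
  · exact hL.2 ▸ hθ
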